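/- **Setting.** For $k=0,1,2,\dots$ let $\Omega=\Omega_k$ be a finite connected simple graph and let $X$ be the lazy simple random walk on it (stay put with probability $1/2$, otherwise move to a uniform neighbour), with transition matrix $P$ and stationary distribution $\pi(x)=\deg x/\sum_y\deg y$. Write $P_x,\mathbb E_x,\mathrm{Var}_x$ for the walk started at $x$, $\tau_A=\inf\{t\ge 0:X_t\in A\}$, $\tau_x=\tau_{\{x\}}$, and $$t_{mix}(\epsilon)=\min\{t\ge 0:\max_x\|P^t(x,\cdot)-\pi\|\le\epsilon\},\qquad \|\mu-\nu\|=\sup_A|\mu(A)-\nu(A)|.$$ For $W\subseteq\Omega$ and $r\in\Omega$, the *edge* $\partial W$ of $W$ seen from $r$ is the set of points of $W$ furthest from $r$ for the walk: those $y\in W$ with $P_x(\tau_r>t)\le P_y(\tau_r>t)$ for all $x\in W$, $t\ge 0$. All points of the edge have the same law of $\tau_r$, written with the subscript $\partial W$ (such a point is also at maximal graph distance from $r$ in $W$). We say that a set $I$ *lies between* $0$ and $c$ if every $x\in I$ separates $c$ from $0$ (as for a line), or if at least $P_x(\tau_0>t)\le P_c(\tau_0>t)$ for all $x\in I$, $t\geq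 0$. **Graphs with a bottleneck.** $\Omega=T_0\cup B\cup S$, where $B=B[0,z]$ is the bottleneck with end points $0\ne z$, $T_0\cap B=\{0\}$, no vertex of $T_0$ other than $0$ has a neighbour outside $T_0$, $S$ is the complement of $D=T_0\cup B$, and $z$ is the only vertex of $D$ with neighbours in $S$. Let $\partial D=\partial T_0$ be the edge of $T_0$ seen from $0$, assumed non-empty. For every $k$ one of the following holds. * *Case A.* $c$ is a point of the edge of $S$ seen from $0$, and $B$ lies between $0$ and $c$. * *Case B.* There is a segment $I=[0,c]$ with $B\subseteq I\subseteq B\cup S$ lying between $0$ and $c$ and finitely many (at least one) pairwise disjoint sets $T_i\subseteq S\cup\{z\}$ with $T_i\cap I=\{n_i\}$, each joined to the rest of the graph only through $n_i$, such that $S\subseteq I\cup\bigcup_iT_i$; the last $n_i$ is $c$; and the edge $\partial T_i$ of $T_i$ seen from $n_i$ is non-empty for each $i$. Let $L=\sum_{s=\tau_0}^{\tau_z^*}\mathbf 1(X_{s-1}\notin T_0,\,X_s\in T_0)$ for the walk started at $0$, where $\tau_z^*=\inf\{s\ge\tau_0:X_s=z\}$. Let $\lambda$ be the length of an excursion of the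 walk from $0$ back to $0$ whose first step is to a vertex of $T_0\setminus\{0\}$, conditioned not to hit $\partial T_0$, and $\theta$ the length of an excursion from $0$ whose first step is to a vertex of $B\setminus\{0\}$, conditioned not to hit $z$ (with mean $0$ if there are no such excursions). **Theorem.** Let $\gamma=\gamma_k>0$ and $\delta=\delta_k\in\mathbb R$ be nondecreasing in $k$. Assume * (C1) $\pi(B\cup S)\to 0$ as $k\to\infty$; * (C2) there is a nondecreasing $h:\mathbb N\to(0,\infty)$, independent of $k$, with $P_0(L\le |z|)\le 1/h(|z|)$ for every $k$, where $|z|$ is the graph distance from $0$ to $z$; * (C3) for every $k$, $\mathbb E_0(\tau_{\partial D})\le\mathbb E_{\partial D}(\tau_0)$ and, in Case B, $\mathbb E_{\partial T_i}(\tau_{n_i})\le\mathbb E_{\partial D}(\tau_0)$ for all $i$; * (H)(a) $\gamma\sqrt{\mathrm{Var}_c(\tau_0)}\,/\,\mathbb E_c(\tau_0)\to 0$ as $k\to\infty$; * (H)(b) $\bigl(\mathbb E_{\partial D}(\tau_0)+\mathbb E[L]\,(\mathbb E[\lambda]+\mathbb E[\theta])\bigr)\,/\,\bigl(\gamma\sqrt{\mathrm{Var}_c(\tau_0)}\bigr)\to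 0$ as $k\to\infty$; * (H1) $\mathbb E_c(\tau_0)+\frac{\gamma}{2}\sqrt{\mathrm{Var}_c(\tau_0)}\ \ge\ \mathbb E_{\partial D}(\tau_0)+\delta\sqrt{\mathrm{Var}_{\partial D}(\tau_0)}$ for every $k$. Then for every $0<\epsilon<1$, $\;t_{mix}(\epsilon)\sim\mathbb E_c(\tau_0)$, that is, $t_{mix}(\epsilon)/\mathbb E_c(\tau_0)\to 1$ as $k\to\infty$. -/

import Mathlib

open Filter Topology MeasureTheory ProbabilityTheory Asymptotics

noncomputable section

namespace Bottleneck

section Walk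

variable {V : Type*} [Fintype V]

open Classical in
/-- Transition matrix of the lazy simple random walk on a finite graph: stay put with probability
`1/2`, otherwise move to a uniformly chosen neighbour (a vertex without neighbours is absorbing). -/
def lazyWalk (G : SimpleGraph V) : Matrix V V ℝ := fun x y =>
  if x = y then (if G.degree x = 0 then 1 else 1 / 2)
  else if G.Adj x y then 1 / (2 * (G.degree x : ℝ)) else 0

theorem lazyWalk_nonneg (G : SimpleGraph V) (x y : V) : 0 ≤ lazyWalk G x y := by
  unfold lazyWalk
  split_ifs <;> positivity

theorem lazyWalk_row_sum (G : SimpleGraph V) (x : V) : ∑ y, lazyWalk G x y = 1 := by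
  classical
  have h : ∀ y, lazyWalk G x y = (if x = y then (if G.degree x = 0 then (1 : ℝ) else 1 / 2) else 0)
      + (if G.Adj x y then 1 / (2 * (G.degree x : ℝ)) else 0) := by
    intro y
    unfold lazyWalk
    by_cases hxy : x = y
    · subst hxy
      simp
    · simp [hxy]
  simp_rw [h]
  rw [Finset.sum_add_distrib, Finset.sum_ite_eq, if_pos (Finset.mem_univ x),
    ← Finset.sum_filter, Finset.sum_const, ← SimpleGraph.neighborFinset_eq_filter G,
    SimpleGraph.card_neighborFinset_eq_degree]
  by_cases hd : G.degree x = 0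
  · simp [hd]
  · have : (G.degree x : ℝ) ≠ 0 := by exact_mod_cast hd
    rw [if_neg hd, nsmul_eq_mul]
    field_simp
    norm_num

open Classical in
/-- The stationary distribution `π(x) = deg x / ∑ deg` of the walk. -/
def stationary (G : SimpleGraph V) (x : V) : ℝ := (G.degree x : ℝ) / ∑ y, (G.degree y : ℝ)

open Classical in
/-- `π(A)`. -/
def stationaryMass (G : SimpleGraph V) (A : Set V) : ℝ := ∑ x with x ∈ A, stationary G x

open Classical in
/-- Total variation distance `sup_A |μ(A) - ν(A)|` of two mass functions. -/
def tvDist (p q : V → ℝ) : ℝ := ⨆ A : Finset V, |∑ x ∈ A, p x - ∑ x ∈ A, q x|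

open Classical in
/-- `t_mix(ε) = min {t ≥ 0 : max_x ‖P^t(x, ·) - π‖ ≤ ε}`. -/
def mixingTime (G : SimpleGraph V) (ε : ℝ) : ℕ :=
  sInf {t : ℕ | ∀ x, tvDist (fun y => (lazyWalk G ^ t) x y) (stationary G) ≤ ε}

variable [MeasurableSpace V] [MeasurableSingletonClass V]

/-- One step of the walk, as a probability measure. -/
def stepMeasure (G : SimpleGraph V) (x : V) : Measure V :=
  ∑ y, ENNReal.ofReal (lazyWalk G x y) • Measure.dirac y

instance (G : SimpleGraph V) (x : V) : IsProbabilityMeasure (stepMeasure G x) := by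
  constructor
  simp only [stepMeasure, Measure.coe_finsetSum, Finset.sum_apply, Measure.smul_apply,
    measure_univ, smul_eq_mul, mul_one]
  rw [← ENNReal.ofReal_sum_of_nonneg (fun y _ => lazyWalk_nonneg G x y), lazyWalk_row_sum,
    ENNReal.ofReal_one]

/-- The walk as a Markov kernel. -/
def stepKernel (G : SimpleGraph V) : Kernel V V where
  toFun := stepMeasure G
  measurable' := measurable_of_countable _

instance (G : SimpleGraph V) : IsMarkovKernel (stepKernel G) :=
  ⟨fun x => inferInstanceAs (IsProbabilityMeasure (stepMeasure G x))⟩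

/-- `P_x`: the law, on the space of trajectories `ω : ℕ → V`, of the walk started from `x`. -/
def pathMeasure (G : SimpleGraph V) (x : V) : Measure (ℕ → V) :=
  Kernel.trajMeasure (X := fun _ : ℕ => V) (Measure.dirac x)
    (fun n => (stepKernel G).comap
      (fun h : (Π _ : Finset.Iic n, V) => h ⟨n, Finset.mem_Iic.2 le_rfl⟩)
      (measurable_pi_apply _))

instance (G : SimpleGraph V) (x : V) : IsProbabilityMeasure (pathMeasure G x) := by
  unfold pathMeasure
  infer_instance

/-- `τ_A`, the first time a trajectory is in `A`. (The junk value `0` of a trajectory that never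
visits `A` only matters on a null event: the graphs below are finite and connected.) -/
def hittingTime (A : Set V) (ω : ℕ → V) : ℕ := sInf {t : ℕ | ω t ∈ A}

/-- `E_x(τ_A)`. -/
def meanHit (G : SimpleGraph V) (x : V) (A : Set V) : ℝ :=
  ∫ ω, (hittingTime A ω : ℝ) ∂(pathMeasure G x)

/-- `Var_x(τ_A)`. -/
def varHit (G : SimpleGraph V) (x : V) (A : Set V) : ℝ :=
  variance (fun ω => (hittingTime A ω : ℝ)) (pathMeasure G x)

/-- `y` is at least as far from `r` as `x`, as seen by the walk: the time to reach `r` from `x` is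
stochastically dominated by the time to reach `r` from `y`, that is,
`P_x(τ_r > t) ≤ P_y(τ_r > t)` for all `t`. -/
def AtLeastAsFar (G : SimpleGraph V) (r x y : V) : Prop :=
  ∀ t : ℕ, (pathMeasure G x).real {ω | t < hittingTime {r} ω} ≤
    (pathMeasure G y).real {ω | t < hittingTime {r} ω}

/-- The edge `∂W` of a part `W` of the graph, seen from its root `r`: the points of `W` furthest
from `r`. The law of `τ_r` is the same from all points of the edge, so that `E_{∂W}(τ_r)` and
`Var_{∂W}(τ_r)` make sense. All points of the edge are also at maximal graph distance from `r`
in `W`. -/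
def edge (G : SimpleGraph V) (r : V) (W : Set V) : Set V :=
  {y | y ∈ W ∧ ∀ x ∈ W, AtLeastAsFar G r x y}

/-- `I` lies between `r` and `c`: either every point of `I` separates `c` from `r` (as when `I`
is a line from `r` to `c`, or a piece of it), or at least no point of `I` is further from `r`
than `c`. -/
def LiesBetween (G : SimpleGraph V) (r c : V) (I : Set V) : Prop :=
  (∀ x ∈ I, ∀ w : G.Walk c r, x ∈ w.support) ∨ ∀ x ∈ I, AtLeastAsFar G r x c

end Walk

/-- A finite connected graph with a bottleneck: the big part `T₀` and the bottleneck `B = B[0,z]`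
meet in the vertex `o` (the vertex `0`) only, `D = T₀ ∪ B`, and the complement `S` of `D` is
attached to `D` at the vertex `z` only. -/
structure Network (V : Type*) [Fintype V] [MeasurableSpace V] [MeasurableSingletonClass V] where
  graph : SimpleGraph V
  connected : graph.Connected
  /-- the vertex `0` -/
  o : V
  /-- the boundary vertex between `D` and `S` -/
  z : V
  /-- the vertex at the far end -/
  c : V
  /-- a point of the edge `∂D` -/
  d : V
  T₀ : Set V
  B : Set V
  inter_eq : T₀ ∩ B = {o}
  z_mem : z ∈ B
  z_ne : z ≠ o
  T₀_exit : ∀ x ∈ T₀, ∀ y ∉ T₀, graph.Adj x y → x = o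
  S_exit : ∀ x ∉ T₀ ∪ B, ∀ y ∈ T₀ ∪ B, graph.Adj x y → y = z
  d_mem : d ∈ edge graph o T₀

namespace Network

variable {V : Type*} [Fintype V] [MeasurableSpace V] [MeasurableSingletonClass V]

/-- `D = T₀ ∪ B[0,z]`. -/
def D (N : Network V) : Set V := N.T₀ ∪ N.B

/-- `S = Dᶜ`. -/
def S (N : Network V) : Set V := N.Dᶜ

/-- The edge `∂D` of `D`, that is `∂T₀`: the points of `T₀` furthest from `0`. -/
def edgeD (N : Network V) : Set V := edge N.graph N.o N.T₀

/-- Case A: `c` is (a point of) the edge of `S`, and the bottleneck lies between `0` and `c`. -/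
def CaseA (N : Network V) : Prop :=
  N.c ∈ edge N.graph N.o N.S ∧ LiesBetween N.graph N.o N.c N.B

/-- Case B: there is a segment `I = [0,c]` which begins with the bottleneck, and `S` consists of
the rest of the segment and of finitely many disjoint graphs `T_i`, each attached to the rest of
the graph at a single point `n_i` of the segment; `c` is the point at which the last one is
attached. -/
structure CaseB (N : Network V) where
  I : Set V
  B_subset : N.B ⊆ I
  I_subset : I ⊆ N.B ∪ N.S
  between : LiesBetween N.graph N.o N.c I
  /-- the number of graphs `T_i` -/
  r : ℕ
  T : Fin r → Set V
  n : Fin r → V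
  T_subset : ∀ i, T i ⊆ insert N.z N.S
  T_inter : ∀ i, T i ∩ I = {n i}
  T_disjoint : ∀ i j, i ≠ j → Disjoint (T i) (T j)
  T_exit : ∀ i, ∀ x ∈ T i, ∀ y ∉ T i, N.graph.Adj x y → x = n i
  S_subset : N.S ⊆ I ∪ ⋃ i, T i
  last : Fin r
  n_last : n last = N.c
  /-- a point of the edge `∂T_i`: the points of `T_i` furthest from `n_i` -/
  e : Fin r → V
  e_mem : ∀ i, e i ∈ edge N.graph (n i) (T i)

/-- `E_c(τ_0)`. -/
def meanC (N : Network V) : ℝ := meanHit N.graph N.c {N.o}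

/-- `Var_c(τ_0)`. -/
def varC (N : Network V) : ℝ := varHit N.graph N.c {N.o}

/-- `E_{∂D}(τ_0)`. -/
def meanD (N : Network V) : ℝ := meanHit N.graph N.d {N.o}

/-- `Var_{∂D}(τ_0)`. -/
def varD (N : Network V) : ℝ := varHit N.graph N.d {N.o}

/-- `τ*_z = inf {s ≥ τ_0 : x_s = z}`. -/
def tauStar (N : Network V) (ω : ℕ → V) : ℕ :=
  sInf {s : ℕ | hittingTime {N.o} ω ≤ s ∧ ω s = N.z}

open Classical in
/-- `L = ∑_{s = τ_0}^{τ*_z} 1(x_{s-1} ∉ T₀, x_s ∈ T₀)`, the number of returns to `T₀` between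
`τ_0` and `τ*_z`. It is used for the walk from `0`, for which `τ_0 = 0`; the term `s = 0` then
vanishes. -/
def returns (N : Network V) (ω : ℕ → V) : ℕ :=
  ∑ s ∈ Finset.Icc (hittingTime {N.o} ω) (N.tauStar ω),
    if ω (s - 1) ∉ N.T₀ ∧ ω s ∈ N.T₀ then 1 else 0

/-- `E[L]`. -/
def meanReturns (N : Network V) : ℝ :=
  ∫ ω, (N.returns ω : ℝ) ∂(pathMeasure N.graph N.o)

/-- The first return time to `0`. -/
def returnTime (N : Network V) (ω : ℕ → V) : ℕ := sInf {s : ℕ | 1 ≤ s ∧ ω s = N.o}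

/-- The trajectory begins with an excursion from `0` into `W` that comes back to `0` before
visiting `F`. -/
def excursion (N : Network V) (W F : Set V) : Set (ℕ → V) :=
  {ω | ω 1 ∈ W \ {N.o} ∧ ∀ s, 1 ≤ s → s < N.returnTime ω → ω s ∉ F}

/-- Mean length of an excursion of the walk from `0` into `W`, conditioned not to hit `F`
(`0` if there are no such excursions). -/
def meanExcursion (N : Network V) (W F : Set V) : ℝ :=
  ∫ ω, (N.returnTime ω : ℝ) ∂((pathMeasure N.graph N.o)[|N.excursion W F])

/-- `E[λ]`: excursions from `0` on `T₀` conditioned not to hit `∂T₀`. -/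
def meanLambda (N : Network V) : ℝ := N.meanExcursion N.T₀ N.edgeD

/-- `E[θ]`: excursions from `0` on `B[0,z]` conditioned not to hit `z`. -/
def meanTheta (N : Network V) : ℝ := N.meanExcursion N.B {N.z}

end Network

end Bottleneck

end

/-! Everything is governed by the hitting time of `0`, which from `c` concentrates around its mean
$M=\mathbb E_c(\tau_0)$: by (H)(a) and $\gamma_k\ge\gamma_0>0$ the standard deviation is $o(M)$, so
Chebyshev applies. Moreover (H)(b) followed by (H)(a) gives $\mathbb E_{\partial D}(\tau_0)=o(M)$.

Lower bound (`le_of_mixed`): the walk from `c` starts outside $T_0$ and can enter it only through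
`0`, so before time about $M$ it is still outside with high probability, while by (C1) the
stationary mass there tends to $0$.

Upper bound (`exists_mixed_le`): from any vertex, `0` is reached by time $(1+o(1))M$ with high
probability. Vertices of $T_0$ are handled by Markov's inequality at $\partial D$. All others are
dominated by `c`, except those of some $T_i$ off the segment, which first go to $n_i$ in time $o(M)$
by (C3); this is `survival_add_le_of_admissible`. It remains to mix from `0` in a further $o(M)$
steps (`abs_lazyWalk_pow_o_sub_le`). For this lazy reversible walk $P^t(0,0)$ is nonincreasing, so
the stationary walk, which hits `0` by time $t$ with probability at least $1-q$, sits at `0` at time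
$t$ with probability at least $(1-q)P^t(0,0)$. Hence $P^t(0,0)\le\pi(0)/(1-q)$, and the $\ell^2$
bound turns this into total variation at most $\sqrt{q/(1-q)}$. Here $q\to0$ because $\pi(T_0)\to1$
and $0$ is hit from $T_0$ in mean time at most $\mathbb E_{\partial D}(\tau_0)$. -/

noncomputable section

namespace Bottleneck

/-! ### Tails of hitting times through first-step recursion. -/

section Survival

variable {V : Type*} [Fintype V]

open Classical in
/-- `P_x(τ_r > t)`, defined by first-step recursion. -/
def survival (G : SimpleGraph V) (r : V) : ℕ → V → ℝ
  | 0, x => if x = r then 0 else 1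
  | t + 1, x => if x = r then 0 else ∑ w, lazyWalk G x w * survival G r t w

variable {G : SimpleGraph V} {r : V}

theorem survival_root (t : ℕ) : survival G r t r = 0 := by
  cases t <;> simp [survival]

theorem survival_zero_of_ne {x : V} (hx : x ≠ r) : survival G r 0 x = 1 := by
  simp [survival, hx]

theorem survival_succ_of_ne (t : ℕ) {x : V} (hx : x ≠ r) :
    survival G r (t + 1) x = ∑ w, lazyWalk G x w * survival G r t w := by
  simp [survival, hx]

theorem survival_nonneg (t : ℕ) (x : V) : 0 ≤ survival G r t x := by
  induction t generalizing x with
  | zero => unfold survival; split_ifs <;> norm_num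
  | succ t ih =>
    unfold survival
    split_ifs
    · rfl
    · exact Finset.sum_nonneg fun w _ => mul_nonneg (lazyWalk_nonneg G x w) (ih w)

/-- Averaging a bound over one step of the walk. -/
theorem sum_lazyWalk_mul_le {f : V → ℝ} {C : ℝ} (x : V) (h : ∀ w, lazyWalk G x w ≠ 0 → f w ≤ C) :
    ∑ w, lazyWalk G x w * f w ≤ C := by
  calc ∑ w, lazyWalk G x w * f w ≤ ∑ w, lazyWalk G x w * C := by
        refine Finset.sum_le_sum fun w _ => ?_
        by_cases hw : lazyWalk G x w = 0
        · simp [hw]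
        · exact mul_le_mul_of_nonneg_left (h w hw) (lazyWalk_nonneg G x w)
    _ = C := by rw [← Finset.sum_mul, lazyWalk_row_sum, one_mul]

theorem le_sum_lazyWalk_mul {f : V → ℝ} {C : ℝ} (x : V) (h : ∀ w, lazyWalk G x w ≠ 0 → C ≤ f w) :
    C ≤ ∑ w, lazyWalk G x w * f w := by
  have := sum_lazyWalk_mul_le (G := G) (f := fun w => -f w) (C := -C) x
    (fun w hw => neg_le_neg (h w hw))
  simp only [mul_neg, Finset.sum_neg_distrib] at this
  linarith

theorem survival_le_one (t : ℕ) (x : V) : survival G r t x ≤ 1 := by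
  induction t generalizing x with
  | zero => unfold survival; split_ifs <;> norm_num
  | succ t ih =>
    by_cases hx : x = r
    · subst hx; simp [survival_root]
    · rw [survival_succ_of_ne t hx]
      exact sum_lazyWalk_mul_le x fun w _ => ih w

/-- As an inequality the recursion also holds at the root, which spares a case split when the target
differs from the current conditioning vertex. -/
theorem survival_succ_le_sum (t : ℕ) (x : V) :
    survival G r (t + 1) x ≤ ∑ w, lazyWalk G x w * survival G r t w := by
  by_cases hx : x = r
  · subst hx
    rw [survival_root]
    exact Finset.sum_nonneg fun w _ => mul_nonneg (lazyWalk_nonneg G x w) (survival_nonneg t w)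
  · exact (survival_succ_of_ne t hx).le

theorem survival_succ_le (t : ℕ) (x : V) : survival G r (t + 1) x ≤ survival G r t x := by
  induction t generalizing x with
  | zero =>
    by_cases hx : x = r
    · subst hx; simp [survival_root]
    · rw [survival_zero_of_ne hx]; exact survival_le_one _ _
  | succ t ih =>
    by_cases hx : x = r
    · subst hx; simp [survival_root]
    · rw [survival_succ_of_ne _ hx, survival_succ_of_ne _ hx]
      exact Finset.sum_le_sum fun w _ => mul_le_mul_of_nonneg_left (ih w) (lazyWalk_nonneg G x w)

theorem survival_antitone (x : V) : Antitone fun t => survival G r t x :=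
  antitone_nat_of_succ_le fun t => survival_succ_le t x

/-- Reaching `r` takes at most as long as reaching `n` and then going from `n` to `r`. -/
theorem survival_add_le (n : V) (a b : ℕ) (x : V) :
    survival G r (a + b) x ≤ survival G n a x + survival G r b n := by
  induction a generalizing x with
  | zero =>
    by_cases hx : x = n
    · subst hx; simp [survival_root]
    · rw [survival_zero_of_ne hx]
      linarith [survival_le_one (G := G) (r := r) (0 + b) x, survival_nonneg (G := G) (r := r) b n]
  | succ a ih =>
    by_cases hx : x = n
    · subst hx
      rw [survival_root, zero_add]
      exact survival_antitone x (by omega)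
    · rw [survival_succ_of_ne a hx, Nat.add_right_comm]
      refine (survival_succ_le_sum (a + b) x).trans ?_
      calc ∑ w, lazyWalk G x w * survival G r (a + b) w
          ≤ ∑ w, lazyWalk G x w * (survival G n a w + survival G r b n) :=
            Finset.sum_le_sum fun w _ => mul_le_mul_of_nonneg_left (ih w) (lazyWalk_nonneg G x w)
        _ = _ := by
            simp_rw [mul_add]
            rw [Finset.sum_add_distrib, ← Finset.sum_mul, lazyWalk_row_sum, one_mul]

/-- Submultiplicativity of the tail of the hitting time. -/
theorem survival_add_le_mul {ρ : ℝ} {s : ℕ} (hρ : ∀ x, survival G r s x ≤ ρ)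
    (t : ℕ) (x : V) : survival G r (s + t + 1) x ≤ ρ * survival G r t x := by
  induction t generalizing x with
  | zero =>
    by_cases hx : x = r
    · subst hx; simp [survival_root]
    · rw [survival_zero_of_ne hx, mul_one]
      exact (survival_antitone x (by omega : s ≤ s + 0 + 1)).trans (hρ x)
  | succ t ih =>
    by_cases hx : x = r
    · subst hx; simp [survival_root]
    · rw [survival_succ_of_ne _ hx, survival_succ_of_ne _ hx, Finset.mul_sum]
      refine Finset.sum_le_sum fun w _ => ?_
      have := mul_le_mul_of_nonneg_left (ih w) (lazyWalk_nonneg G x w)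
      rw [show s + (t + 1) = s + t + 1 by ring]
      linarith

theorem lazyWalk_ne_zero {x y : V} (h : lazyWalk G x y ≠ 0) : x = y ∨ G.Adj x y := by
  by_contra! hc
  exact h (by simp [lazyWalk, hc.1, hc.2])

theorem lazyWalk_pos_of_adj {x y : V} (h : G.Adj x y) : 0 < lazyWalk G x y := by
  classical
  have hd : 0 < G.degree x := (G.degree_pos_iff_exists_adj x).2 ⟨y, h⟩
  have hd' : (0 : ℝ) < G.degree x := by exact_mod_cast hd
  unfold lazyWalk
  rw [if_neg h.ne, if_pos h]
  convert (by positivity : (0 : ℝ) < 1 / (2 * (G.degree x : ℝ)))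

theorem half_le_lazyWalk_self (x : V) : 1 / 2 ≤ lazyWalk G x x := by
  unfold lazyWalk
  rw [if_pos rfl]
  split_ifs <;> norm_num

/-- If every walk from `y` to `r` visits `x`, then `r` is hit from `y` later than from `x`. -/
theorem survival_le_of_separates (t : ℕ) {x y : V} (h : ∀ w : G.Walk y r, x ∈ w.support) :
    survival G r t x ≤ survival G r t y := by
  induction t generalizing y with
  | zero =>
    by_cases hy : y = r
    · subst hy
      have : x = y := by simpa using h SimpleGraph.Walk.nil
      rw [this]
    · rw [survival_zero_of_ne hy]; exact survival_le_one _ _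
  | succ t ih =>
    by_cases hxy : x = y
    · rw [hxy]
    have hy : y ≠ r := by
      rintro rfl
      exact hxy (by simpa using h SimpleGraph.Walk.nil)
    -- After one step from `y` the vertex `x` still separates: prepending `y ≠ x` to a walk from the
    -- neighbour adds no visit to `x`. The step spent is absorbed by monotonicity in time.
    rw [survival_succ_of_ne t hy]
    refine (survival_succ_le t x).trans (le_sum_lazyWalk_mul y fun w hw => ?_)
    rcases lazyWalk_ne_zero hw with rfl | hadj
    · exact ih h
    · refine ih fun p => ?_
      have := h (SimpleGraph.Walk.cons hadj p)
      simpa [hxy] using this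

/-- A connected walk reaches `r` with positive probability within some time, from everywhere. -/
theorem exists_survival_lt_one (hG : G.Connected) (r : V) :
    ∃ n, ∀ x, survival G r n x < 1 := by
  have key : ∀ x : V, G.Walk x r → ∃ n, survival G r n x < 1 := by
    intro x p
    induction p with
    | nil => exact ⟨0, by rw [survival_root]; norm_num⟩
    | @cons u v w hadj p ih =>
      obtain ⟨n, hn⟩ := ih
      refine ⟨n + 1, (survival_succ_le_sum n u).trans_lt ?_⟩
      calc ∑ y, lazyWalk G u y * survival G w n y < ∑ y, lazyWalk G u y := by
            refine Finset.sum_lt_sum (fun y _ => ?_) ⟨v, Finset.mem_univ v, ?_⟩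
            · exact mul_le_of_le_one_right (lazyWalk_nonneg G u y) (survival_le_one n y)
            · exact mul_lt_of_lt_one_right (lazyWalk_pos_of_adj hadj) hn
        _ = 1 := lazyWalk_row_sum G u
  choose n hn using fun x => key x (hG.preconnected x r).some
  refine ⟨∑ x, n x, fun x => lt_of_le_of_lt (survival_antitone x ?_) (hn x)⟩
  exact Finset.single_le_sum (f := n) (fun _ _ => Nat.zero_le _) (Finset.mem_univ x)

/-- The hitting time of a vertex has an exponentially decaying tail. -/
theorem exists_survival_le_geometric (hG : G.Connected) (r : V) :
    ∃ C q : ℝ, 0 < C ∧ 0 < q ∧ q < 1 ∧ ∀ t x, survival G r t x ≤ C * q ^ t := by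
  obtain ⟨n, hn⟩ := exists_survival_lt_one hG r
  have : Nonempty V := ⟨r⟩
  obtain ⟨x₀, hx₀⟩ := Finite.exists_max fun x => survival G r n x
  obtain ⟨ρ, hρ1, hρ2⟩ := exists_between (hn x₀)
  have hρ0 : 0 < ρ := (survival_nonneg n x₀).trans_lt hρ1
  have hρ : ∀ x, survival G r n x ≤ ρ := fun x => (hx₀ x).trans hρ1.le
  -- The rate is chosen so that the tail shrinks by `q ^ (n + 1) = ρ` per block of `n + 1` steps;
  -- the constant `(q ^ (n + 1))⁻¹` makes the bound at least `1` during the first block.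
  set q : ℝ := ρ ^ (((n + 1 : ℕ) : ℝ)⁻¹) with hq
  have hq0 : 0 < q := Real.rpow_pos_of_pos hρ0 _
  have hqn : q ^ (n + 1) = ρ := Real.rpow_inv_natCast_pow hρ0.le (by omega)
  have hq1 : q < 1 := Real.rpow_lt_one hρ0.le hρ2 (by positivity)
  refine ⟨(q ^ (n + 1))⁻¹, q, by positivity, hq0, hq1, fun t => ?_⟩
  induction t using Nat.strong_induction_on with
  | _ t ih =>
    intro x
    by_cases ht : t < n + 1
    · refine (survival_le_one t x).trans ?_
      rw [inv_mul_eq_div, one_le_div (by positivity)]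
      exact pow_le_pow_of_le_one hq0.le hq1.le ht.le
    · obtain ⟨m, rfl⟩ : ∃ m, t = n + m + 1 := ⟨t - (n + 1), by omega⟩
      refine (survival_add_le_mul hρ m x).trans ?_
      have := mul_le_mul_of_nonneg_left (ih m (by omega) x) hρ0.le
      refine this.trans_eq ?_
      rw [← hqn]
      ring

end Survival

/-! ### Powers of the transition matrix, hitting times and reversibility. -/

section Mixing

open Classical

variable {V : Type*} [Fintype V] {G : SimpleGraph V}

theorem lazyWalk_pow_nonneg (t : ℕ) (x y : V) : 0 ≤ (lazyWalk G ^ t) x y := by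
  induction t generalizing x with
  | zero => rw [pow_zero, Matrix.one_apply]; split_ifs <;> norm_num
  | succ t ih =>
    rw [pow_succ', Matrix.mul_apply]
    exact Finset.sum_nonneg fun w _ => mul_nonneg (lazyWalk_nonneg G x w) (ih w)

theorem lazyWalk_pow_succ_sum (t : ℕ) (x : V) (A : Finset V) :
    ∑ y ∈ A, (lazyWalk G ^ (t + 1)) x y
      = ∑ w, lazyWalk G x w * ∑ y ∈ A, (lazyWalk G ^ t) w y := by
  simp_rw [pow_succ', Matrix.mul_apply, Finset.mul_sum]
  exact Finset.sum_comm

theorem lazyWalk_pow_row_sum (t : ℕ) (x : V) : ∑ y, (lazyWalk G ^ t) x y = 1 := by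
  induction t generalizing x with
  | zero => simp [Matrix.one_apply]
  | succ t ih => rw [lazyWalk_pow_succ_sum]; simp [ih, lazyWalk_row_sum]

theorem lazyWalk_pow_sum_le_one (t : ℕ) (x : V) (A : Finset V) :
    ∑ y ∈ A, (lazyWalk G ^ t) x y ≤ 1 := by
  rw [← lazyWalk_pow_row_sum (G := G) t x]
  exact Finset.sum_le_sum_of_subset_of_nonneg (Finset.subset_univ A)
    fun y _ _ => lazyWalk_pow_nonneg t x y

/-- A walk which can leave `A` only through `r ∉ A` is still in `A` before it hits `r`. -/
theorem survival_le_lazyWalk_pow_sum {r : V} (A : Finset V)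
    (hA : ∀ x ∈ A, ∀ y ∉ A, G.Adj x y → y = r) (t : ℕ) {x : V} (hx : x ∈ A) :
    survival G r t x ≤ ∑ y ∈ A, (lazyWalk G ^ t) x y := by
  induction t generalizing x with
  | zero =>
    refine (survival_le_one 0 x).trans_eq ?_
    simp [Matrix.one_apply, hx]
  | succ t ih =>
    rw [lazyWalk_pow_succ_sum]
    refine (survival_succ_le_sum t x).trans (Finset.sum_le_sum fun w _ => ?_)
    by_cases hw : lazyWalk G x w = 0
    · simp [hw]
    refine mul_le_mul_of_nonneg_left ?_ (lazyWalk_nonneg G x w)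
    by_cases hwA : w ∈ A
    · exact ih hwA
    · rcases lazyWalk_ne_zero hw with rfl | hadj
      · exact absurd hx hwA
      · rw [hA x hx w hwA hadj, survival_root]
        exact Finset.sum_nonneg fun y _ => lazyWalk_pow_nonneg t _ y

/-- Once the walk has hit `r`, it has the law of the walk from `r`. -/
theorem abs_lazyWalk_pow_sum_sub_le {r : V} (A : Finset V) {a η : ℝ} {m : ℕ} (ha0 : 0 ≤ a)
    (ha1 : a ≤ 1) (h : ∀ s, m ≤ s → |∑ y ∈ A, (lazyWalk G ^ s) r y - a| ≤ η) (t : ℕ) (x : V) :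
    |∑ y ∈ A, (lazyWalk G ^ (t + m)) x y - a| ≤ survival G r t x + η := by
  have hη : 0 ≤ η := (abs_nonneg _).trans (h m le_rfl)
  induction t generalizing x with
  | zero =>
    by_cases hx : x = r
    · subst hx
      rw [survival_root, zero_add, zero_add]
      exact h m le_rfl
    · rw [survival_zero_of_ne hx, zero_add]
      have h1 := lazyWalk_pow_sum_le_one (G := G) m x A
      have h2 : 0 ≤ ∑ y ∈ A, (lazyWalk G ^ m) x y :=
        Finset.sum_nonneg fun y _ => lazyWalk_pow_nonneg m x y
      rw [abs_le]
      constructor <;> linarith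
  | succ t ih =>
    by_cases hx : x = r
    · subst hx
      rw [survival_root, zero_add]
      exact h _ (by omega)
    · rw [survival_succ_of_ne t hx, Nat.add_right_comm, lazyWalk_pow_succ_sum]
      have h1 : ∑ w, lazyWalk G x w * ∑ y ∈ A, (lazyWalk G ^ (t + m)) w y - a
          = ∑ w, lazyWalk G x w * (∑ y ∈ A, (lazyWalk G ^ (t + m)) w y - a) := by
        simp_rw [mul_sub]
        rw [Finset.sum_sub_distrib, ← Finset.sum_mul, lazyWalk_row_sum, one_mul]
      have h2 : ∑ w, lazyWalk G x w * survival G r t w + η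
          = ∑ w, lazyWalk G x w * (survival G r t w + η) := by
        simp_rw [mul_add]
        rw [Finset.sum_add_distrib, ← Finset.sum_mul, lazyWalk_row_sum, one_mul]
      rw [h1, h2]
      refine (Finset.abs_sum_le_sum_abs _ _).trans (Finset.sum_le_sum fun w _ => ?_)
      rw [abs_mul, abs_of_nonneg (lazyWalk_nonneg G x w)]
      exact mul_le_mul_of_nonneg_left (ih w) (lazyWalk_nonneg G x w)

/-! ### Reversibility -/

theorem stationary_nonneg (x : V) : 0 ≤ stationary G x := by
  unfold stationary; positivity

theorem stationary_pos [Nontrivial V] (hG : G.Connected) (x : V) : 0 < stationary G x := by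
  have hd : ∀ y, 0 < G.degree y := fun y => hG.preconnected.degree_pos_of_nontrivial y
  have : 0 < ∑ y, (G.degree y : ℝ) :=
    Finset.sum_pos (fun y _ => by exact_mod_cast hd y) ⟨x, Finset.mem_univ x⟩
  have := hd x
  unfold stationary
  positivity

theorem stationary_sum [Nontrivial V] (hG : G.Connected) : ∑ x, stationary G x = 1 := by
  obtain ⟨x⟩ := hG.nonempty
  have h := stationary_pos hG x
  unfold stationary at h ⊢
  rw [← Finset.sum_div, div_self]
  rintro h0
  simp [h0] at h

theorem stationary_mul_lazyWalk (x y : V) :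
    stationary G x * lazyWalk G x y = stationary G y * lazyWalk G y x := by
  by_cases hxy : x = y
  · rw [hxy]
  by_cases hadj : G.Adj x y
  · have hx : (G.degree x : ℝ) ≠ 0 := by
      exact_mod_cast ((G.degree_pos_iff_exists_adj x).2 ⟨y, hadj⟩).ne'
    have hy : (G.degree y : ℝ) ≠ 0 := by
      exact_mod_cast ((G.degree_pos_iff_exists_adj y).2 ⟨x, hadj.symm⟩).ne'
    simp only [stationary, lazyWalk, hxy, Ne.symm hxy, hadj, hadj.symm, if_true, if_false]
    field_simp
  · have hadj' : ¬ G.Adj y x := fun h => hadj h.symm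
    simp [lazyWalk, hxy, Ne.symm hxy, hadj, hadj']

theorem stationary_mul_lazyWalk_pow (t : ℕ) (x y : V) :
    stationary G x * (lazyWalk G ^ t) x y = stationary G y * (lazyWalk G ^ t) y x := by
  induction t generalizing x y with
  | zero =>
    by_cases hxy : x = y
    · rw [hxy]
    · simp [hxy, Ne.symm hxy]
  | succ t ih =>
    rw [pow_succ', Matrix.mul_apply, ← pow_succ', pow_succ, Matrix.mul_apply, Finset.mul_sum,
      Finset.mul_sum]
    refine Finset.sum_congr rfl fun w _ => ?_
    rw [← mul_assoc, stationary_mul_lazyWalk, mul_right_comm, ih, mul_assoc]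

theorem sum_stationary_mul_lazyWalk_pow (t : ℕ) (y : V) :
    ∑ x, stationary G x * (lazyWalk G ^ t) x y = stationary G y := by
  simp_rw [fun x => stationary_mul_lazyWalk_pow (G := G) t x y]
  rw [← Finset.mul_sum, lazyWalk_pow_row_sum, mul_one]

theorem sum_sum_stationary_left (u : V → ℝ) :
    ∑ x, ∑ y, stationary G x * lazyWalk G x y * u x = ∑ x, stationary G x * u x := by
  refine Finset.sum_congr rfl fun x _ => ?_
  rw [← Finset.sum_mul, ← Finset.mul_sum, lazyWalk_row_sum, mul_one]

theorem sum_sum_stationary_right (u : V → ℝ) :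
    ∑ x, ∑ y, stationary G x * lazyWalk G x y * u y = ∑ x, stationary G x * u x := by
  rw [Finset.sum_comm, ← sum_sum_stationary_left]
  refine Finset.sum_congr rfl fun x _ => Finset.sum_congr rfl fun y _ => ?_
  rw [stationary_mul_lazyWalk]

/-- The lazy walk is a contraction of `ℓ²(π)`. -/
theorem energy_le (u : V → ℝ) :
    ∑ x, stationary G x * (u x * ∑ y, lazyWalk G x y * u y)
      ≤ ∑ x, stationary G x * u x ^ 2 := by
  have h : ∑ x, stationary G x * (u x * ∑ y, lazyWalk G x y * u y)
      ≤ ∑ x, ∑ y, (stationary G x * lazyWalk G x y * u x ^ 2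
        + stationary G x * lazyWalk G x y * u y ^ 2) / 2 := by
    refine Finset.sum_le_sum fun x _ => ?_
    rw [Finset.mul_sum, Finset.mul_sum]
    refine Finset.sum_le_sum fun y _ => ?_
    have := mul_nonneg (mul_nonneg (stationary_nonneg (G := G) x) (lazyWalk_nonneg G x y))
      (sq_nonneg (u x - u y))
    linarith
  refine h.trans_eq ?_
  simp_rw [← Finset.sum_div, Finset.sum_add_distrib]
  rw [sum_sum_stationary_left fun x => u x ^ 2, sum_sum_stationary_right fun x => u x ^ 2]
  ring

/-- The lazy walk is a positive operator on `ℓ²(π)`. -/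
theorem energy_nonneg (u : V → ℝ) :
    0 ≤ ∑ x, stationary G x * (u x * ∑ y, lazyWalk G x y * u y) := by
  -- Laziness enters here: the diagonal terms alone, with $P(x,x)\ge 1/2$ and $(2u(x))^2$, give
  -- $2\|u\|^2$, exactly the square terms in the expansion of the full double sum.
  have h1 : ∑ x, 2 * (stationary G x * u x ^ 2)
      ≤ ∑ x, ∑ y, stationary G x * lazyWalk G x y * (u x + u y) ^ 2 := by
    refine Finset.sum_le_sum fun x _ => ?_
    have h0 : ∀ y, 0 ≤ stationary G x * lazyWalk G x y * (u x + u y) ^ 2 := fun y =>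
      mul_nonneg (mul_nonneg (stationary_nonneg x) (lazyWalk_nonneg G x y)) (sq_nonneg _)
    refine le_trans ?_ (Finset.single_le_sum (fun y _ => h0 y) (Finset.mem_univ x))
    have := mul_le_mul_of_nonneg_left (half_le_lazyWalk_self (G := G) x)
      (mul_nonneg (stationary_nonneg (G := G) x) (sq_nonneg (u x)))
    linarith
  have h2 : ∑ x, ∑ y, stationary G x * lazyWalk G x y * (u x + u y) ^ 2
      = 2 * ∑ x, stationary G x * u x ^ 2
        + 2 * ∑ x, stationary G x * (u x * ∑ y, lazyWalk G x y * u y) := by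
    have h3 : ∀ x y, stationary G x * lazyWalk G x y * (u x + u y) ^ 2
        = stationary G x * lazyWalk G x y * u x ^ 2 + stationary G x * lazyWalk G x y * u y ^ 2
          + 2 * (stationary G x * (u x * (lazyWalk G x y * u y))) := fun x y => by ring
    simp_rw [h3, Finset.sum_add_distrib, Finset.mul_sum]
    rw [sum_sum_stationary_left fun x => u x ^ 2, sum_sum_stationary_right fun x => u x ^ 2,
      ← Finset.mul_sum]
    ring
  rw [← Finset.mul_sum] at h1
  linarith

/-- By reversibility the $\ell^2(\pi)$ inner product of two columns at `r` depends only on `s + t`,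
so operator inequalities become inequalities between return probabilities. -/
theorem sum_stationary_mul_pow_mul_pow (r : V) (s t : ℕ) :
    ∑ x, stationary G x * ((lazyWalk G ^ s) x r * (lazyWalk G ^ t) x r)
      = stationary G r * (lazyWalk G ^ (s + t)) r r := by
  rw [pow_add, Matrix.mul_apply, Finset.mul_sum]
  refine Finset.sum_congr rfl fun x _ => ?_
  rw [← mul_assoc, stationary_mul_lazyWalk_pow, mul_assoc]

/-- Write $a_t=P^t(r,r)$. Contraction applied to $P^s(\cdot,r)$ gives $a_{2s+1}\le a_{2s}$.
Positivity applied to $P^s(\cdot,r)-P^{s+1}(\cdot,r)$ gives $a_{2s+1}-2a_{2s+2}+a_{2s+3}\ge0$, and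
with $a_{2s+3}\le a_{2s+2}$ this settles odd times. -/
theorem lazyWalk_pow_self_succ_le [Nontrivial V] (hG : G.Connected) (r : V) (t : ℕ) :
    (lazyWalk G ^ (t + 1)) r r ≤ (lazyWalk G ^ t) r r := by
  have hπ := stationary_pos hG r
  have step : ∀ s x, ∑ y, lazyWalk G x y * (lazyWalk G ^ s) y r = (lazyWalk G ^ (s + 1)) x r :=
    fun s x => by rw [pow_succ', Matrix.mul_apply]
  have even : ∀ s, (lazyWalk G ^ (s + (s + 1))) r r ≤ (lazyWalk G ^ (s + s)) r r := fun s => by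
    have h := energy_le (G := G) fun x => (lazyWalk G ^ s) x r
    simp_rw [step, sq, sum_stationary_mul_pow_mul_pow] at h
    exact le_of_mul_le_mul_left h hπ
  rcases Nat.even_or_odd' t with ⟨s, rfl | rfl⟩
  · simpa only [two_mul, add_assoc] using even s
  · have h1 := energy_nonneg (G := G) fun x => (lazyWalk G ^ s) x r - (lazyWalk G ^ (s + 1)) x r
    have h2 := even (s + 1)
    have h3 : ∀ x, stationary G x * (((lazyWalk G ^ s) x r - (lazyWalk G ^ (s + 1)) x r)
        * ((lazyWalk G ^ (s + 1)) x r - (lazyWalk G ^ (s + 1 + 1)) x r))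
        = stationary G x * ((lazyWalk G ^ s) x r * (lazyWalk G ^ (s + 1)) x r)
        - stationary G x * ((lazyWalk G ^ s) x r * (lazyWalk G ^ (s + 1 + 1)) x r)
        - stationary G x * ((lazyWalk G ^ (s + 1)) x r * (lazyWalk G ^ (s + 1)) x r)
        + stationary G x * ((lazyWalk G ^ (s + 1)) x r * (lazyWalk G ^ (s + 1 + 1)) x r) :=
      fun x => by ring
    have h5 : ∀ x, ∑ y, lazyWalk G x y * ((lazyWalk G ^ s) y r - (lazyWalk G ^ (s + 1)) y r)
        = (lazyWalk G ^ (s + 1)) x r - (lazyWalk G ^ (s + 1 + 1)) x r := fun x => by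
      rw [← step s, ← step (s + 1), ← Finset.sum_sub_distrib]
      exact Finset.sum_congr rfl fun y _ => mul_sub _ _ _
    simp_rw [h5, h3, Finset.sum_add_distrib, Finset.sum_sub_distrib,
      sum_stationary_mul_pow_mul_pow, ← mul_sub, ← mul_add] at h1
    have h4 := nonneg_of_mul_nonneg_right h1 hπ
    rw [show s + (s + 1 + 1) = 2 * s + 1 + 1 by ring, show s + (s + 1) = 2 * s + 1 by ring,
      show s + 1 + (s + 1) = 2 * s + 1 + 1 by ring] at h4
    rw [show s + 1 + (s + 1) = 2 * s + 1 + 1 by ring] at h2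
    linarith

theorem lazyWalk_pow_self_antitone [Nontrivial V] (hG : G.Connected) (r : V) :
    Antitone fun t => (lazyWalk G ^ t) r r :=
  antitone_nat_of_succ_le fun t => lazyWalk_pow_self_succ_le hG r t

/-- Decompose at the first visit to `r`: the time left is at most `T`, so by monotonicity of the
return probability the walk is back at `r` with probability at least $P^T(r,r)$. Keeping `T` fixed
lets the induction on `t` go through. -/
theorem one_sub_survival_mul_le [Nontrivial V] (hG : G.Connected) (r : V) {t T : ℕ} (htT : t ≤ T)
    (x : V) : (1 - survival G r t x) * (lazyWalk G ^ T) r r ≤ (lazyWalk G ^ t) x r := by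
  induction t generalizing x with
  | zero =>
    by_cases hx : x = r
    · subst hx
      rw [survival_root, sub_zero, one_mul]
      exact lazyWalk_pow_self_antitone hG x htT
    · rw [survival_zero_of_ne hx, sub_self, zero_mul]
      exact lazyWalk_pow_nonneg _ _ _
  | succ t ih =>
    by_cases hx : x = r
    · subst hx
      rw [survival_root, sub_zero, one_mul]
      exact lazyWalk_pow_self_antitone hG x htT
    · have h1 : 1 - survival G r (t + 1) x = ∑ w, lazyWalk G x w * (1 - survival G r t w) := by
        simp_rw [mul_sub, mul_one]
        rw [Finset.sum_sub_distrib, lazyWalk_row_sum, survival_succ_of_ne t hx]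
      rw [h1, pow_succ', Matrix.mul_apply, Finset.sum_mul]
      refine Finset.sum_le_sum fun w _ => ?_
      rw [mul_assoc]
      exact mul_le_mul_of_nonneg_left (ih (by omega) w) (lazyWalk_nonneg G x w)

/-- The return probability to `r` is close to `π(r)` once the stationary walk has hit `r`. -/
theorem one_sub_survival_mul_return_le [Nontrivial V] (hG : G.Connected) (r : V) (t : ℕ) :
    (1 - ∑ x, stationary G x * survival G r t x) * (lazyWalk G ^ t) r r ≤ stationary G r := by
  rw [← stationary_sum hG, ← Finset.sum_sub_distrib, ← sum_stationary_mul_lazyWalk_pow t r,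
    Finset.sum_mul]
  refine Finset.sum_le_sum fun x _ => ?_
  have := mul_le_mul_of_nonneg_left (one_sub_survival_mul_le hG r le_rfl x (t := t))
    (stationary_nonneg (G := G) x)
  linarith

/-- The `ℓ²` bound on the total variation distance to stationarity. -/
theorem sq_lazyWalk_pow_sum_sub_le [Nontrivial V] (hG : G.Connected) (r : V) (t : ℕ)
    (A : Finset V) :
    (∑ y ∈ A, (lazyWalk G ^ t) r y - ∑ y ∈ A, stationary G y) ^ 2
      ≤ (lazyWalk G ^ (t + t)) r r / stationary G r - 1 := by
  have hπ := stationary_pos hG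
  have h1 : |∑ y ∈ A, (lazyWalk G ^ t) r y - ∑ y ∈ A, stationary G y|
      ≤ ∑ y, |(lazyWalk G ^ t) r y - stationary G y| := by
    rw [← Finset.sum_sub_distrib]
    exact (Finset.abs_sum_le_sum_abs _ _).trans
      (Finset.sum_le_sum_of_subset_of_nonneg (Finset.subset_univ A) fun _ _ _ => abs_nonneg _)
  -- Cauchy–Schwarz with weights $\pi(y)$ of total mass one; reversibility then evaluates the
  -- $\chi^2$ sum in `h3`.
  have h2 := Finset.sq_sum_div_le_sum_sq_div Finset.univ
    (fun y => |(lazyWalk G ^ t) r y - stationary G y|) (fun y _ => hπ y)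
  rw [stationary_sum hG, div_one] at h2
  have h3 : ∑ y, |(lazyWalk G ^ t) r y - stationary G y| ^ 2 / stationary G y
      = (lazyWalk G ^ (t + t)) r r / stationary G r - 1 := by
    have h4 : ∀ y, |(lazyWalk G ^ t) r y - stationary G y| ^ 2 / stationary G y
        = (lazyWalk G ^ t) r y * (lazyWalk G ^ t) y r / stationary G r
          - 2 * (lazyWalk G ^ t) r y + stationary G y := fun y => by
      have hy := (hπ y).ne'
      have hr := (hπ r).ne'
      have h5 : (lazyWalk G ^ t) y r = stationary G r * (lazyWalk G ^ t) r y / stationary G y := by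
        rw [eq_div_iff hy, stationary_mul_lazyWalk_pow, mul_comm]
      rw [sq_abs, h5]
      field_simp
      ring
    simp_rw [h4, Finset.sum_add_distrib, Finset.sum_sub_distrib]
    rw [← Finset.sum_div, ← Matrix.mul_apply, ← pow_add, ← Finset.mul_sum, lazyWalk_pow_row_sum,
      stationary_sum hG]
    ring
  rw [h3] at h2
  rw [← sq_abs]
  exact (pow_le_pow_left₀ (abs_nonneg _) h1 2).trans h2

end Mixing

/-! ### Identifying the recursion with the law of the hitting time on trajectories; moment bounds.
-/

section PathMeasure

open scoped ENNReal

theorem lt_hittingTime_iff {V : Type*} {A : Set V} {ω : ℕ → V} {t : ℕ} :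
    t < hittingTime A ω ↔ (∃ s, ω s ∈ A) ∧ ∀ s ≤ t, ω s ∉ A := by
  constructor
  · intro h
    refine ⟨?_, fun s hs hA => ?_⟩
    · by_contra! hc
      have : {s : ℕ | ω s ∈ A} = ∅ := Set.eq_empty_of_forall_notMem hc
      simp [hittingTime, this] at h
    · exact absurd (Nat.sInf_le (s := {s : ℕ | ω s ∈ A}) hA) (by unfold hittingTime at h; omega)
  · rintro ⟨hne, h⟩
    by_contra! hc
    exact h _ hc (Nat.sInf_mem (s := {s : ℕ | ω s ∈ A}) hne)

theorem measurableSet_avoid {V : Type*} [MeasurableSpace V] [MeasurableSingletonClass V]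
    (r : V) (t : ℕ) : MeasurableSet {ω : ℕ → V | ∀ s ≤ t, ω s ≠ r} := by
  have : {ω : ℕ → V | ∀ s ≤ t, ω s ≠ r}
      = ⋂ s, ⋂ (_ : s ≤ t), (fun ω : ℕ → V => ω s) ⁻¹' {r}ᶜ := by
    ext ω
    simp
  rw [this]
  exact MeasurableSet.iInter fun s => MeasurableSet.iInter fun _ =>
    measurable_pi_apply s (measurableSet_singleton r).compl

variable {V : Type*} [Fintype V] [MeasurableSpace V] [MeasurableSingletonClass V]
  {G : SimpleGraph V}

theorem measurable_hittingTime (A : Set V) :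
    Measurable (hittingTime A : (ℕ → V) → ℕ) := by
  have hA : MeasurableSet A := A.toFinite.measurableSet
  refine measurable_of_Ioi fun t => ?_
  have : hittingTime A ⁻¹' Set.Ioi t
      = (⋃ s, (fun ω : ℕ → V => ω s) ⁻¹' A) ∩ ⋂ s, ⋂ (_ : s ≤ t), (fun ω : ℕ → V => ω s) ⁻¹' Aᶜ := by
    ext ω
    simp [lt_hittingTime_iff]
  rw [this]
  exact (MeasurableSet.iUnion fun s => measurable_pi_apply s hA).inter
    (MeasurableSet.iInter fun s => MeasurableSet.iInter fun _ => measurable_pi_apply s hA.compl)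

theorem lintegral_stepMeasure (x : V) (f : V → ℝ≥0∞) :
    ∫⁻ y, f y ∂(stepMeasure G x) = ∑ y, ENNReal.ofReal (lazyWalk G x y) * f y := by
  simp [stepMeasure, lintegral_finsetSum_measure]

theorem comp_map_dirac {α β γ : Type*} [MeasurableSpace α] [MeasurableSpace β] [MeasurableSpace γ]
    (κ : Kernel β γ) {f : α → β} (hf : Measurable f) (x : α) :
    κ ∘ₘ (Measure.dirac x).map f = κ (f x) := by
  rw [Measure.map_dirac' hf, Measure.dirac_bind κ.measurable]

theorem pathMeasure_map_zero (x : V) :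
    (pathMeasure G x).map (fun ω => ω 0) = Measure.dirac x := by
  let κ : (n : ℕ) → Kernel (Π _ : Finset.Iic n, V) V := fun n => (stepKernel G).comap
    (fun h : (Π _ : Finset.Iic n, V) => h ⟨n, Finset.mem_Iic.2 le_rfl⟩) (measurable_pi_apply _)
  let p : (Π _ : Finset.Iic 0, V) := fun _ => x
  have h0 : pathMeasure G x = Kernel.traj (X := fun _ : ℕ => V) κ 0 p :=
    comp_map_dirac (Kernel.traj (X := fun _ : ℕ => V) κ 0)
      (MeasurableEquiv.piUnique fun _ : Finset.Iic 0 => V).symm.measurable x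
  have h := Kernel.traj_map_frestrictLe_apply (X := fun _ : ℕ => V) (κ := κ) 0 0 p
  rw [Kernel.partialTraj_self, Kernel.id_apply] at h
  have h2 := congrArg (Measure.map fun p : (Π _ : Finset.Iic 0, V) =>
    p ⟨0, Finset.mem_Iic.2 le_rfl⟩) h
  rw [Measure.map_map (by fun_prop) (by fun_prop), Measure.map_dirac' (by fun_prop)] at h2
  rw [h0]
  exact h2

/-- The Markov property at time `t`, tested against functions of the whole past and the next state.
-/
theorem lintegral_pathMeasure_succ (x : V) (t : ℕ)
    (F : (Π _ : Finset.Iic t, V) → V → ℝ≥0∞) :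
    ∫⁻ ω, F (fun s => ω s) (ω (t + 1)) ∂(pathMeasure G x)
      = ∫⁻ ω, ∑ y, ENNReal.ofReal (lazyWalk G (ω t) y) * F (fun s => ω s) y ∂(pathMeasure G x) := by
  have h := Kernel.map_frestrictLe_trajMeasure_compProd_eq_map_trajMeasure (X := fun _ : ℕ => V)
    (μ₀ := Measure.dirac x)
    (κ := fun n => (stepKernel G).comap
      (fun h : (Π _ : Finset.Iic n, V) => h ⟨n, Finset.mem_Iic.2 le_rfl⟩)
      (measurable_pi_apply _)) (a := t)
  have hF : Measurable (Function.uncurry F) := measurable_of_countable _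
  have h2 := congrArg (fun μ => ∫⁻ p, Function.uncurry F p ∂μ) h
  beta_reduce at h2
  rw [Measure.lintegral_compProd hF, lintegral_map (measurable_of_countable _) (by fun_prop),
    lintegral_map hF (by fun_prop)] at h2
  refine Eq.trans h2.symm ?_
  refine lintegral_congr fun ω => ?_
  exact lintegral_stepMeasure (ω t) _

/-- While `r` has been avoided up to time `t`, the chance of avoiding it `u` steps longer has
constant mean along `t + u`. The induction trades one step of trajectory for one step of recursion;
`u = 0` gives the law of the hitting time. -/
theorem lintegral_avoid_survival (r x : V) (t u : ℕ) :
    ∫⁻ ω, {ω : ℕ → V | ∀ s ≤ t, ω s ≠ r}.indicator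
        (fun ω => ENNReal.ofReal (survival G r u (ω t))) ω ∂(pathMeasure G x)
      = ENNReal.ofReal (survival G r (t + u) x) := by
  classical
  induction t generalizing u with
  | zero =>
    have h1 : ∀ ω : ℕ → V, {ω : ℕ → V | ∀ s ≤ 0, ω s ≠ r}.indicator
        (fun ω => ENNReal.ofReal (survival G r u (ω 0))) ω
          = ENNReal.ofReal (survival G r u (ω 0)) := fun ω => by
      by_cases h : ω 0 = r
      · simp [h, survival_root, Set.indicator]
      · simp [h, Set.indicator]
    simp_rw [h1]
    have h2 : ∫⁻ y, ENNReal.ofReal (survival G r u y) ∂((pathMeasure G x).map fun ω => ω 0)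
        = ∫⁻ ω, ENNReal.ofReal (survival G r u (ω 0)) ∂(pathMeasure G x) :=
      lintegral_map (measurable_of_countable _) (by fun_prop)
    rw [← h2, pathMeasure_map_zero, lintegral_dirac, zero_add]
  | succ t ih =>
    let F : (Π _ : Finset.Iic t, V) → V → ℝ≥0∞ := fun p y =>
      if ∀ s, p s ≠ r then ENNReal.ofReal (survival G r u y) else 0
    have hF : ∀ (ω : ℕ → V) y, F (fun s => ω s) y
        = if ∀ s ≤ t, ω s ≠ r then ENNReal.ofReal (survival G r u y) else 0 := fun ω y => by
      simp only [F]
      congr 1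
      simp
    have h1 : ∀ ω : ℕ → V, {ω : ℕ → V | ∀ s ≤ t + 1, ω s ≠ r}.indicator
        (fun ω => ENNReal.ofReal (survival G r u (ω (t + 1)))) ω
          = F (fun s => ω s) (ω (t + 1)) := fun ω => by
      rw [hF]
      by_cases h : ω (t + 1) = r
      · simp [h, survival_root, Set.indicator]
      · have : (∀ s ≤ t + 1, ω s ≠ r) ↔ ∀ s ≤ t, ω s ≠ r := by
          refine ⟨fun h' s hs => h' s (by omega), fun h' s hs => ?_⟩
          rcases Nat.lt_or_ge t s with hts | hts
          · rwa [show s = t + 1 by omega]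
          · exact h' s hts
        simp only [Set.indicator, Set.mem_ofPred_eq, this]
    simp_rw [h1]
    rw [lintegral_pathMeasure_succ, show t + 1 + u = t + (u + 1) by ring, ← ih (u + 1)]
    refine lintegral_congr fun ω => ?_
    simp_rw [hF]
    by_cases h : ∀ s ≤ t, ω s ≠ r
    · simp only [Set.indicator, Set.mem_ofPred_eq, if_pos h]
      rw [survival_succ_of_ne u (h t le_rfl), ENNReal.ofReal_sum_of_nonneg
        fun y _ => mul_nonneg (lazyWalk_nonneg G _ y) (survival_nonneg u y)]
      exact Finset.sum_congr rfl fun y _ => (ENNReal.ofReal_mul (lazyWalk_nonneg G _ y)).symm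
    · simp [Set.indicator, h]

theorem pathMeasure_avoid (r x : V) (t : ℕ) :
    pathMeasure G x {ω | ∀ s ≤ t, ω s ≠ r} = ENNReal.ofReal (survival G r t x) := by
  have h := lintegral_avoid_survival (G := G) r x t 0
  rw [add_zero] at h
  rw [← h, ← lintegral_indicator_one (measurableSet_avoid r t)]
  refine lintegral_congr fun ω => ?_
  by_cases hω : ∀ s ≤ t, ω s ≠ r
  · simp [Set.indicator, survival_zero_of_ne (G := G) (hω t le_rfl)]
  · simp [Set.indicator, hω]

theorem pathMeasure_never (hG : G.Connected) (r x : V) :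
    pathMeasure G x {ω | ∀ s, ω s ≠ r} = 0 := by
  obtain ⟨C, q, hC, hq0, hq1, h⟩ := exists_survival_le_geometric hG r
  have hlim : Tendsto (fun t : ℕ => ENNReal.ofReal (C * q ^ t)) atTop (𝓝 0) := by
    have := (tendsto_pow_atTop_nhds_zero_of_lt_one hq0.le hq1).const_mul C
    rw [mul_zero] at this
    simpa using ENNReal.tendsto_ofReal this
  refine le_antisymm (ge_of_tendsto' hlim fun t => ?_) zero_le
  calc pathMeasure G x {ω | ∀ s, ω s ≠ r} ≤ pathMeasure G x {ω | ∀ s ≤ t, ω s ≠ r} :=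
        measure_mono fun ω hω s _ => hω s
    _ = ENNReal.ofReal (survival G r t x) := pathMeasure_avoid r x t
    _ ≤ _ := ENNReal.ofReal_le_ofReal (h t x)

/-- Trajectories that never visit `r` have `hittingTime` equal to `0` and so drop out of this event;
the geometric tail makes them null. -/
theorem pathMeasure_lt_hittingTime (hG : G.Connected) (r x : V) (t : ℕ) :
    pathMeasure G x {ω | t < hittingTime {r} ω} = ENNReal.ofReal (survival G r t x) := by
  rw [← pathMeasure_avoid]
  refine measure_congr ?_
  have h0 : ∀ᵐ ω ∂(pathMeasure G x), ∃ s, ω s = r := by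
    rw [ae_iff]
    simpa using pathMeasure_never hG r x
  filter_upwards [h0] with ω hω
  refine propext ?_
  change t < hittingTime {r} ω ↔ ∀ s ≤ t, ω s ≠ r
  rw [lt_hittingTime_iff]
  exact and_iff_right hω

theorem pathMeasure_real_lt_hittingTime (hG : G.Connected) (r x : V) (t : ℕ) :
    (pathMeasure G x).real {ω | t < hittingTime {r} ω} = survival G r t x := by
  rw [Measure.real, pathMeasure_lt_hittingTime hG, ENNReal.toReal_ofReal (survival_nonneg t x)]

theorem atLeastAsFar_iff (hG : G.Connected) {r x y : V} :
    AtLeastAsFar G r x y ↔ ∀ t, survival G r t x ≤ survival G r t y := by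
  simp_rw [AtLeastAsFar, pathMeasure_real_lt_hittingTime hG]

theorem memLp_two_hittingTime (hG : G.Connected) (r x : V) :
    MemLp (fun ω => (hittingTime {r} ω : ℝ)) 2 (pathMeasure G x) := by
  have hm : Measurable fun ω : ℕ → V => (hittingTime {r} ω : ℝ) :=
    measurable_from_nat.comp (measurable_hittingTime {r})
  rw [memLp_two_iff_integrable_sq hm.aestronglyMeasurable]
  refine ⟨(hm.pow_const 2).aestronglyMeasurable, ?_⟩
  -- Since $n^2=\sum_{t<n}(2t+1)$, the second moment is $\sum_t(2t+1)P(\tau>t)$, which the geometric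
  -- tail makes finite.
  have h1 : ∀ n : ℕ, ((n : ℝ≥0∞)) ^ 2 = ∑' t : ℕ, if t < n then ((2 * t + 1 : ℕ) : ℝ≥0∞) else 0 := by
    intro n
    rw [tsum_eq_sum (s := Finset.range n) (fun t ht => if_neg (by simpa using ht))]
    rw [Finset.sum_congr rfl fun t ht => if_pos (Finset.mem_range.1 ht)]
    rw [← Nat.cast_sum, ← Nat.cast_pow]
    congr 1
    induction n with
    | zero => simp
    | succ n ih => rw [Finset.sum_range_succ, ← ih]; ring
  rw [HasFiniteIntegral]
  have h2 : ∀ ω : ℕ → V, ‖(hittingTime {r} ω : ℝ) ^ 2‖ₑ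
      = ∑' t : ℕ, ((2 * t + 1 : ℕ) : ℝ≥0∞) * {ω | t < hittingTime {r} ω}.indicator 1 ω := fun ω => by
    rw [Real.enorm_eq_ofReal (by positivity), ENNReal.ofReal_pow (by positivity),
      ENNReal.ofReal_natCast, h1]
    refine tsum_congr fun t => ?_
    simp [Set.indicator]
  have hs : ∀ t, MeasurableSet {ω : ℕ → V | t < hittingTime {r} ω} := fun t =>
    measurable_hittingTime {r} (measurableSet_Ioi (a := t))
  simp_rw [h2]
  rw [lintegral_tsum fun t => ((measurable_one.indicator (hs t)).const_mul _).aemeasurable]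
  obtain ⟨C, q, hC, hq0, hq1, h⟩ := exists_survival_le_geometric hG r
  have hsum : Summable fun t : ℕ => (2 * t + 1 : ℝ) * (C * q ^ t) := by
    have a := (summable_pow_mul_geometric_of_norm_lt_one 1
      (by rwa [Real.norm_of_nonneg hq0.le] : ‖q‖ < 1)).mul_left (2 * C)
    have b := (summable_geometric_of_lt_one hq0.le hq1).mul_left C
    refine (a.add b).congr fun t => ?_
    ring
  refine lt_of_le_of_lt (ENNReal.tsum_le_tsum (g := fun t : ℕ =>
    ENNReal.ofReal ((2 * t + 1 : ℝ) * (C * q ^ t))) fun t => ?_) hsum.tsum_ofReal_lt_top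
  rw [lintegral_const_mul _ (measurable_one.indicator (hs t)), lintegral_indicator_one (hs t),
    pathMeasure_lt_hittingTime hG, ENNReal.ofReal_mul (by positivity)]
  refine mul_le_mul' (le_of_eq ?_) (ENNReal.ofReal_le_ofReal (h t x))
  rw [← ENNReal.ofReal_natCast]
  push_cast
  rfl

/-- Markov's inequality for a hitting time. -/
theorem mul_survival_le_meanHit (hG : G.Connected) (r x : V) (t : ℕ) :
    (t + 1 : ℝ) * survival G r t x ≤ meanHit G x {r} := by
  have h := mul_meas_ge_le_integral_of_nonneg (μ := pathMeasure G x)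
    (f := fun ω => (hittingTime {r} ω : ℝ)) (Eventually.of_forall fun ω => Nat.cast_nonneg _)
    ((memLp_two_hittingTime hG r x).integrable (by norm_num)) (t + 1 : ℝ)
  have h2 : {ω : ℕ → V | (t + 1 : ℝ) ≤ (hittingTime {r} ω : ℝ)} = {ω | t < hittingTime {r} ω} := by
    ext ω
    exact_mod_cast Iff.rfl
  rwa [h2, pathMeasure_real_lt_hittingTime hG] at h

theorem survival_le_meanHit_div (hG : G.Connected) (r x : V) (t : ℕ) :
    survival G r t x ≤ meanHit G x {r} / (t + 1) := by
  rw [le_div_iff₀ (by positivity), mul_comm]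
  exact mul_survival_le_meanHit hG r x t

theorem meanHit_nonneg (x : V) (A : Set V) : 0 ≤ meanHit G x A :=
  integral_nonneg fun _ => Nat.cast_nonneg _

/-- Chebyshev's inequality for a hitting time. -/
theorem pathMeasure_real_abs_sub_le (hG : G.Connected) (r x : V) {a : ℝ} (ha : 0 < a) :
    (pathMeasure G x).real {ω | a ≤ |(hittingTime {r} ω : ℝ) - meanHit G x {r}|}
      ≤ varHit G x {r} / a ^ 2 := by
  have h := meas_ge_le_variance_div_sq (memLp_two_hittingTime hG r x) ha
  exact ENNReal.toReal_le_of_le_ofReal (div_nonneg (variance_nonneg _ _) (by positivity)) h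

theorem survival_le_varHit_div (hG : G.Connected) (r x : V) {a : ℝ} (ha : 0 < a) {t : ℕ}
    (ht : meanHit G x {r} + a ≤ t + 1) : survival G r t x ≤ varHit G x {r} / a ^ 2 := by
  rw [← pathMeasure_real_lt_hittingTime hG]
  refine le_trans (measureReal_mono fun ω hω => ?_) (pathMeasure_real_abs_sub_le hG r x ha)
  have h1 : (t + 1 : ℝ) ≤ hittingTime {r} ω := by exact_mod_cast hω
  have h2 : a ≤ (hittingTime {r} ω : ℝ) - meanHit G x {r} := by linarith
  exact h2.trans (le_abs_self _)

theorem one_sub_survival_le_varHit_div (hG : G.Connected) (r x : V) {a : ℝ} (ha : 0 < a) {t : ℕ}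
    (ht : t + a ≤ meanHit G x {r}) : 1 - survival G r t x ≤ varHit G x {r} / a ^ 2 := by
  have hs : MeasurableSet {ω : ℕ → V | t < hittingTime {r} ω} :=
    measurable_hittingTime {r} (measurableSet_Ioi (a := t))
  rw [← pathMeasure_real_lt_hittingTime hG, ← probReal_compl_eq_one_sub hs]
  refine le_trans (measureReal_mono fun ω hω => ?_) (pathMeasure_real_abs_sub_le hG r x ha)
  have h1 : (hittingTime {r} ω : ℝ) ≤ t := by
    have : ¬ t < hittingTime {r} ω := hω
    exact_mod_cast not_lt.1 this
  have h2 : a ≤ -((hittingTime {r} ω : ℝ) - meanHit G x {r}) := by linarith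
  exact h2.trans (neg_le_abs _)

end PathMeasure

/-! ### Total variation bounds and stationary mass. -/

section Stationarity

open Classical

theorem tvDist_le {V : Type*} {p q : V → ℝ} {ε : ℝ} (h : ∀ A : Finset V, |∑ x ∈ A, p x - ∑ x ∈ A, q x| ≤ ε) :
    tvDist p q ≤ ε :=
  ciSup_le h

theorem sum_stationary_compl_le {V : Type*} [Fintype V] {G : SimpleGraph V} {T A : Set V} (h : ∀ x ∉ T, x ∈ A) :
    ∑ x with x ∉ T, stationary G x ≤ stationaryMass G A := by
  unfold stationaryMass
  refine Finset.sum_le_sum_of_subset_of_nonneg (fun x hx => ?_) fun x _ _ => stationary_nonneg x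
  rw [Finset.mem_filter] at hx ⊢
  exact ⟨hx.1, h x hx.2⟩

theorem le_tvDist {V : Type*} [Fintype V] (p q : V → ℝ) (A : Finset V) :
    |∑ x ∈ A, p x - ∑ x ∈ A, q x| ≤ tvDist p q :=
  le_ciSup (f := fun A : Finset V => |∑ x ∈ A, p x - ∑ x ∈ A, q x|)
    (Set.finite_range _).bddAbove A

end Stationarity

/-! ### Hitting `0` and mixing on a graph with a bottleneck. -/

namespace Network

open Classical

variable {V : Type*} [Fintype V] [MeasurableSpace V] [MeasurableSingletonClass V] (N : Network V)

/-- The standing assumption: Case A, or Case B with quick returns from the edges of the `T_i`. -/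
def Admissible : Prop :=
  N.CaseA ∨ ∃ Q : N.CaseB, ∀ i, meanHit N.graph (Q.e i) {Q.n i} ≤ N.meanD

theorem nontrivial (N : Network V) : Nontrivial V := ⟨N.z, N.o, N.z_ne⟩

theorem o_mem_T₀ : N.o ∈ N.T₀ :=
  (Set.ext_iff.1 N.inter_eq N.o).2 rfl |>.1

theorem z_notMem_T₀ : N.z ∉ N.T₀ := fun h =>
  N.z_ne ((Set.ext_iff.1 N.inter_eq N.z).1 ⟨h, N.z_mem⟩)

variable {N}

theorem survival_le_of_liesBetween {r c x : V} {I : Set V} (h : LiesBetween N.graph r c I)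
    (hx : x ∈ I) (t : ℕ) : survival N.graph r t x ≤ survival N.graph r t c := by
  rcases h with h | h
  · exact survival_le_of_separates t (h x hx)
  · exact (atLeastAsFar_iff N.connected).1 (h x hx) t

theorem survival_le_of_mem_edge {r x y : V} {W : Set V} (hy : y ∈ edge N.graph r W) (hx : x ∈ W)
    (t : ℕ) : survival N.graph r t x ≤ survival N.graph r t y :=
  (atLeastAsFar_iff N.connected).1 (hy.2 x hx) t

theorem survival_le_of_mem_T₀ {x : V} (hx : x ∈ N.T₀) (t : ℕ) :
    survival N.graph N.o t x ≤ N.meanD / (t + 1) :=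
  (survival_le_of_mem_edge N.d_mem hx t).trans (survival_le_meanHit_div N.connected _ _ t)

theorem meanD_nonneg : 0 ≤ N.meanD := meanHit_nonneg _ _

theorem CaseB.n_mem (Q : N.CaseB) (i : Fin Q.r) : Q.n i ∈ Q.T i ∧ Q.n i ∈ Q.I :=
  (Set.ext_iff.1 (Q.T_inter i) (Q.n i)).2 rfl

theorem c_notMem_T₀ (h : N.Admissible) : N.c ∉ N.T₀ := by
  rcases h with h | ⟨Q, -⟩
  · exact fun hc => h.1.1 (Or.inl hc)
  · rw [← Q.n_last]
    rcases Q.T_subset _ (Q.n_mem Q.last).1 with h | h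
    · rw [h]; exact N.z_notMem_T₀
    · exact fun hc => h (Or.inl hc)

theorem c_ne_o (h : N.Admissible) : N.c ≠ N.o := fun hc =>
  c_notMem_T₀ h (hc ▸ N.o_mem_T₀)

/-- From anywhere, the vertex `0` is hit essentially no later than from `c`. -/
theorem survival_add_le_of_admissible (h : N.Admissible) (s u : ℕ) (x : V) :
    survival N.graph N.o (s + u) x ≤ N.meanD / (s + 1) + survival N.graph N.o u N.c := by
  have hm : 0 ≤ N.meanD / (s + 1) := div_nonneg meanD_nonneg (by positivity)
  have hc : 0 ≤ survival N.graph N.o u N.c := survival_nonneg _ _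
  have far : survival N.graph N.o (s + u) x ≤ survival N.graph N.o (s + u) N.c →
      survival N.graph N.o (s + u) x ≤ N.meanD / (s + 1) + survival N.graph N.o u N.c := fun hx => by
    have := survival_antitone (G := N.graph) (r := N.o) N.c (show u ≤ s + u by omega)
    simp only at this
    linarith
  by_cases hT : x ∈ N.T₀
  · have h1 := survival_le_of_mem_T₀ hT s
    have h2 := survival_antitone (G := N.graph) (r := N.o) x (show s ≤ s + u by omega)
    simp only at h2
    linarith
  rcases h with h | ⟨Q, hQ⟩
  · by_cases hB : x ∈ N.B
    · exact far (survival_le_of_liesBetween h.2 hB _)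
    · exact far (survival_le_of_mem_edge h.1 (fun hD => hD.elim hT hB) _)
  · by_cases hI : x ∈ Q.I
    · exact far (survival_le_of_liesBetween Q.between hI _)
    · have hS : x ∈ N.S := fun hD => hD.elim hT fun hB => hI (Q.B_subset hB)
      obtain ⟨i, hi⟩ := Set.mem_iUnion.1 ((Q.S_subset hS).resolve_left hI)
      -- Off the segment the trip splits at `Q.n i`: time `s` to get there, controlled by the edge
      -- of `Q.T i`, then time `u` to reach `0` from a point of the segment, dominated by `c`.
      refine (survival_add_le (Q.n i) s u x).trans (add_le_add ?_ ?_)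
      · refine (survival_le_of_mem_edge (Q.e_mem i) hi s).trans ?_
        refine (survival_le_meanHit_div N.connected _ _ s).trans ?_
        exact div_le_div_of_nonneg_right (hQ i) (by positivity)
      · exact survival_le_of_liesBetween Q.between (Q.n_mem i).2 u

/-- `π(B ∪ S)`. -/
def farMass (N : Network V) : ℝ := stationaryMass N.graph (N.B ∪ N.S)

theorem sum_stationary_compl_T₀_le :
    ∑ x with x ∉ N.T₀, stationary N.graph x ≤ N.farMass := by
  refine sum_stationary_compl_le fun x hx => ?_
  by_cases hB : x ∈ N.B
  · exact Or.inl hB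
  · exact Or.inr fun hD => hD.elim hx hB

/-- Markov's inequality at the edge covers starting points in `T₀`; all other starting points are
charged their full stationary mass. -/
theorem sum_stationary_mul_survival_le (t : ℕ) :
    ∑ x, stationary N.graph x * survival N.graph N.o t x ≤ N.meanD / (t + 1) + N.farMass := by
  have := N.nontrivial
  have hm : 0 ≤ N.meanD / (t + 1) := div_nonneg meanD_nonneg (by positivity)
  calc ∑ x, stationary N.graph x * survival N.graph N.o t x
      ≤ ∑ x, (stationary N.graph x * (N.meanD / (t + 1))
          + if x ∉ N.T₀ then stationary N.graph x else 0) := by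
        refine Finset.sum_le_sum fun x _ => ?_
        have h0 := stationary_nonneg (G := N.graph) x
        by_cases hx : x ∈ N.T₀
        · rw [if_neg (not_not.2 hx), add_zero]
          exact mul_le_mul_of_nonneg_left (survival_le_of_mem_T₀ hx t) h0
        · rw [if_pos hx]
          have := mul_le_of_le_one_right h0 (survival_le_one (G := N.graph) (r := N.o) t x)
          have := mul_nonneg h0 hm
          linarith
    _ ≤ _ := by
        rw [Finset.sum_add_distrib, ← Finset.sum_mul, stationary_sum N.connected, one_mul,
          ← Finset.sum_filter]
        exact add_le_add_right sum_stationary_compl_T₀_le _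

/-- The walk started from `0` mixes as soon as the stationary walk has hit `0`. -/
theorem abs_lazyWalk_pow_o_sub_le {q : ℝ} (hq1 : q < 1) {v : ℕ}
    (hq : N.meanD / (v + 1) + N.farMass ≤ q) {w : ℕ} (hw : v ≤ w) (A : Finset V) :
    |∑ y ∈ A, (lazyWalk N.graph ^ w) N.o y - ∑ y ∈ A, stationary N.graph y|
      ≤ √(q / (1 - q)) := by
  have := N.nontrivial
  have hπ := stationary_pos N.connected N.o
  refine Real.abs_le_sqrt ((sq_lazyWalk_pow_sum_sub_le N.connected N.o w A).trans ?_)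
  have h1 := one_sub_survival_mul_return_le N.connected N.o (w + w)
  have h2 := sum_stationary_mul_survival_le (N := N) (w + w)
  have h3 : N.meanD / ((w + w : ℕ) + 1) ≤ N.meanD / (v + 1) := by
    refine div_le_div_of_nonneg_left meanD_nonneg (by positivity) ?_
    have : v ≤ w + w := by omega
    have : (v : ℝ) ≤ ((w + w : ℕ) : ℝ) := by exact_mod_cast this
    linarith
  have hp := lazyWalk_pow_nonneg (G := N.graph) (w + w) N.o N.o
  -- The relative return probability is thus at most $1/(1-q)$, and $1/(1-q)-1=q/(1-q)$ is the
  -- quantity under the root.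
  have h4 : (1 - q) * (lazyWalk N.graph ^ (w + w)) N.o N.o ≤ stationary N.graph N.o :=
    (mul_le_mul_of_nonneg_right (by linarith) hp).trans h1
  have h5 : 0 < 1 - q := by linarith
  rw [sub_le_iff_le_add, div_le_iff₀ hπ, div_add_one h5.ne', add_sub_cancel, one_div_mul_eq_div,
    le_div_iff₀ h5]
  linarith

/-- Three stretches of time: `s` for short trips inside `T₀` or some $T_i$, `u` for the trip from
`c` to `0`, and `v` to mix from `0`. -/
theorem tvDist_lazyWalk_pow_le (h : N.Admissible) {q : ℝ} (hq1 : q < 1) {v : ℕ}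
    (hq : N.meanD / (v + 1) + N.farMass ≤ q) (s u : ℕ) (x : V) :
    tvDist (fun y => (lazyWalk N.graph ^ (s + u + v)) x y) (stationary N.graph)
      ≤ N.meanD / (s + 1) + survival N.graph N.o u N.c + √(q / (1 - q)) := by
  have := N.nontrivial
  refine tvDist_le fun A => ?_
  have hA : ∑ y ∈ A, stationary N.graph y ≤ 1 := by
    rw [← stationary_sum N.connected]
    exact Finset.sum_le_sum_of_subset_of_nonneg (Finset.subset_univ A)
      fun y _ _ => stationary_nonneg y
  have h1 := abs_lazyWalk_pow_sum_sub_le A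
    (Finset.sum_nonneg fun y _ => stationary_nonneg y) hA
    (fun w hw => abs_lazyWalk_pow_o_sub_le hq1 hq hw A) (s + u) x
  exact h1.trans (add_le_add_left (survival_add_le_of_admissible h s u x) _)

theorem meanC_pos (h : N.Admissible) : 0 < N.meanC := by
  have h1 := mul_survival_le_meanHit N.connected N.o N.c 0
  rw [survival_zero_of_ne (c_ne_o h)] at h1
  unfold meanC
  norm_num at h1
  linarith

/-- Upper bound for the mixing time. -/
theorem exists_mixed_le (h : N.Admissible) {η ε q : ℝ} (hη : 0 < η)
    (hq : N.meanD / (η * N.meanC) + N.farMass ≤ q) (hq1 : q < 1)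
    (hε : N.meanD / (η * N.meanC) + N.varC / (η * N.meanC) ^ 2 + √(q / (1 - q)) ≤ ε) :
    ∃ t : ℕ, (∀ x, tvDist (fun y => (lazyWalk N.graph ^ t) x y) (stationary N.graph) ≤ ε) ∧
      (t : ℝ) ≤ (1 + 3 * η) * N.meanC := by
  have hM := meanC_pos h
  have hηM : 0 < η * N.meanC := mul_pos hη hM
  set s := ⌊η * N.meanC⌋₊ with hs
  set u := ⌊(1 + η) * N.meanC⌋₊ with hu
  have hs1 : η * N.meanC < s + 1 := Nat.lt_floor_add_one _
  have hu1 : (1 + η) * N.meanC < u + 1 := Nat.lt_floor_add_one _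
  have hs2 : (s : ℝ) ≤ η * N.meanC := Nat.floor_le hηM.le
  have hu2 : (u : ℝ) ≤ (1 + η) * N.meanC := Nat.floor_le (by positivity)
  have hms : N.meanD / (s + 1) ≤ N.meanD / (η * N.meanC) :=
    div_le_div_of_nonneg_left meanD_nonneg hηM hs1.le
  have hc : survival N.graph N.o u N.c ≤ N.varC / (η * N.meanC) ^ 2 :=
    survival_le_varHit_div N.connected N.o N.c hηM (by unfold meanC at *; linarith)
  -- The mixing stretch also has length `s`, so the total is at most $\eta+(1+\eta)+\eta$ times the
  -- mean. Rounding down is harmless because the tail bounds involve `s + 1` and `u + 1`.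
  refine ⟨s + u + s, fun x => ?_, ?_⟩
  · refine (tvDist_lazyWalk_pow_le h hq1 (by linarith) s u x).trans ?_
    linarith
  · push_cast
    linarith

/-- Lower bound for the time at which the walk is mixed. -/
theorem le_of_mixed (h : N.Admissible) {η ε : ℝ} (hη : 0 < η) {t : ℕ}
    (ht : ∀ x, tvDist (fun y => (lazyWalk N.graph ^ t) x y) (stationary N.graph) ≤ ε)
    (hε : ε + N.farMass + N.varC / (η * N.meanC) ^ 2 < 1) :
    (1 - η) * N.meanC ≤ t := by
  by_contra! hlt
  have hηM : 0 < η * N.meanC := mul_pos hη (meanC_pos h)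
  have h1 : 1 - survival N.graph N.o t N.c ≤ N.varC / (η * N.meanC) ^ 2 :=
    one_sub_survival_le_varHit_div N.connected N.o N.c hηM (by unfold meanC at *; linarith)
  -- The test set is the complement of `T₀`: it contains `c`, is left only through `0`, and has
  -- small stationary mass.
  have h2 := survival_le_lazyWalk_pow_sum (G := N.graph) (r := N.o)
    (Finset.univ.filter fun x => x ∉ N.T₀) (fun x hx y hy hadj => by
      simp only [Finset.mem_filter, Finset.mem_univ, true_and, not_not] at hx hy
      exact N.T₀_exit y hy x hx hadj.symm) t (x := N.c) (by simpa using c_notMem_T₀ h)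
  have h3 := (le_abs_self _).trans ((le_tvDist _ _ (Finset.univ.filter fun x => x ∉ N.T₀)).trans
    (ht N.c))
  have h4 := sum_stationary_compl_T₀_le (N := N)
  linarith

theorem mixingTime_bounds (h : N.Admissible) {η ε q : ℝ} (hη : 0 < η)
    (hq : N.meanD / (η * N.meanC) + N.farMass ≤ q) (hq1 : q < 1)
    (hε : N.meanD / (η * N.meanC) + N.varC / (η * N.meanC) ^ 2 + √(q / (1 - q)) ≤ ε)
    (hε1 : ε + N.farMass + N.varC / (η * N.meanC) ^ 2 < 1) :
    |(mixingTime N.graph ε : ℝ) - N.meanC| ≤ 3 * η * N.meanC := by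
  obtain ⟨t, ht, htM⟩ := exists_mixed_le h hη hq hq1 hε
  have hne : {t : ℕ | ∀ x, tvDist (fun y => (lazyWalk N.graph ^ t) x y) (stationary N.graph)
    ≤ ε}.Nonempty := ⟨t, ht⟩
  have h1 : (mixingTime N.graph ε : ℝ) ≤ t := by
    have : mixingTime N.graph ε ≤ t := Nat.sInf_le (show t ∈ {t : ℕ | _} from ht)
    exact_mod_cast this
  have h2 := le_of_mixed h hη (Nat.sInf_mem hne) hε1
  have h3 : 0 < η * N.meanC := mul_pos hη (meanC_pos h)
  change (1 - η) * N.meanC ≤ (mixingTime N.graph ε : ℝ) at h2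
  rw [abs_le]
  constructor <;> linarith

theorem meanReturns_mul_nonneg : 0 ≤ N.meanReturns * (N.meanLambda + N.meanTheta) :=
  mul_nonneg (integral_nonneg fun _ => Nat.cast_nonneg _)
    (add_nonneg (integral_nonneg fun _ => Nat.cast_nonneg _)
      (integral_nonneg fun _ => Nat.cast_nonneg _))

end Network

end Bottleneck

end

/-! ### Passage to the limit. -/

theorem theorem1 {V : ℕ → Type*} [∀ k, Fintype (V k)] [∀ k, MeasurableSpace (V k)]
    [∀ k, MeasurableSingletonClass (V k)]
    (N : ∀ k, Bottleneck.Network (V k))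
    (γ δ : ℕ → ℝ) (hγ_pos : ∀ k, 0 < γ k) (hγ : Monotone γ) (hδ : Monotone δ)
    -- in Case B also: returning from `∂T_i` to `n_i` takes on average at most `E_{∂D}(τ_0)`
    (hcase : ∀ k, (N k).CaseA ∨ ∃ Q : (N k).CaseB,
      ∀ i, Bottleneck.meanHit (N k).graph (Q.e i) {Q.n i} ≤ (N k).meanD)
    (hC1 : Tendsto (fun k => Bottleneck.stationaryMass (N k).graph ((N k).B ∪ (N k).S))
      atTop (𝓝 0))
    (hC2 : ∃ h : ℕ → ℝ, Monotone h ∧ (∀ n, 0 < h n) ∧ ∀ k,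
      (Bottleneck.pathMeasure (N k).graph (N k).o).real
        {ω | (N k).returns ω ≤ (N k).graph.dist (N k).o (N k).z}
        ≤ 1 / h ((N k).graph.dist (N k).o (N k).z))
    (hC3 : ∀ k, Bottleneck.meanHit (N k).graph (N k).o (N k).edgeD ≤ (N k).meanD)
    (hHa : (fun k => γ k * √((N k).varC)) =o[atTop] fun k => (N k).meanC)
    (hHb : (fun k => (N k).meanD
        + (N k).meanReturns * ((N k).meanLambda + (N k).meanTheta))
      =o[atTop] fun k => γ k * √((N k).varC))
    (hH1 : ∀ k, (N k).meanD + δ k * √((N k).varD) ≤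
      (N k).meanC + γ k / 2 * √((N k).varC)) :
    ∀ ε : ℝ, 0 < ε → ε < 1 →
      (fun k => (Bottleneck.mixingTime (N k).graph ε : ℝ)) ~[atTop] fun k => (N k).meanC := by
  intro ε hε0 hε1
  have hM : ∀ k, 0 < (N k).meanC := fun k => Bottleneck.Network.meanC_pos (hcase k)
  have hD : Tendsto (fun k => (N k).meanD / (N k).meanC) atTop (𝓝 0) := by
    refine ((IsBigO.of_bound 1 (Eventually.of_forall fun k => ?_)).trans_isLittleO
      (hHb.trans hHa)).tendsto_div_nhds_zero
    have h1 := (N k).meanD_nonneg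
    have h2 := (N k).meanReturns_mul_nonneg
    rw [Real.norm_of_nonneg h1, Real.norm_of_nonneg (add_nonneg h1 h2)]
    linarith
  have hσ : Tendsto (fun k => (N k).varC / (N k).meanC ^ 2) atTop (𝓝 0) := by
    have h1 : (fun k => √((N k).varC)) =o[atTop] fun k => (N k).meanC := by
      -- Monotonicity keeps `γ k` above `γ 0 > 0`, so the factor `γ k` can be removed from (H)(a).
      refine (IsBigO.of_bound (γ 0)⁻¹ (Eventually.of_forall fun k => ?_)).trans_isLittleO hHa
      have hs := Real.sqrt_nonneg (N k).varC
      rw [Real.norm_of_nonneg hs, Real.norm_of_nonneg (mul_nonneg (hγ_pos k).le hs),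
        ← mul_assoc, inv_mul_eq_div]
      exact le_mul_of_one_le_left hs ((one_le_div (hγ_pos 0)).2 (hγ (Nat.zero_le k)))
    have h2 := h1.tendsto_div_nhds_zero.pow 2
    rw [zero_pow two_ne_zero] at h2
    refine h2.congr fun k => ?_
    rw [div_pow, Real.sq_sqrt]
    exact variance_nonneg _ _
  rw [IsEquivalent, isLittleO_iff]
  intro c hc
  -- The two-sided bound of `mixingTime_bounds` has relative error `3 * η`.
  set η : ℝ := c / 3 with hη
  have hη0 : 0 < η := by positivity
  have hD' : Tendsto (fun k => (N k).meanD / (η * (N k).meanC)) atTop (𝓝 0) := by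
    have := hD.div_const η
    rw [zero_div] at this
    refine this.congr fun k => ?_
    rw [div_div, mul_comm]
  have hσ' : Tendsto (fun k => (N k).varC / (η * (N k).meanC) ^ 2) atTop (𝓝 0) := by
    have := hσ.div_const (η ^ 2)
    rw [zero_div] at this
    refine this.congr fun k => ?_
    rw [div_div, mul_pow, mul_comm]
  have hq : Tendsto (fun k => (N k).meanD / (η * (N k).meanC) + (N k).farMass) atTop (𝓝 0) := by
    rw [← add_zero (0 : ℝ)]
    exact hD'.add hC1
  have hr : Tendsto (fun k => √(((N k).meanD / (η * (N k).meanC) + (N k).farMass)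
      / (1 - ((N k).meanD / (η * (N k).meanC) + (N k).farMass)))) atTop (𝓝 0) := by
    simpa using (hq.div (hq.const_sub 1) (by norm_num)).sqrt
  have hup := (hD'.add hσ').add hr
  have hlow := (hC1.const_add ε).add hσ'
  simp only [add_zero] at hup hlow
  filter_upwards [hq.eventually_lt_const one_pos, hup.eventually_lt_const hε0,
    hlow.eventually_lt_const hε1] with k h1 h2 h3
  have h := Bottleneck.Network.mixingTime_bounds (hcase k) hη0 le_rfl h1 h2.le h3
  rw [Pi.sub_apply, Real.norm_eq_abs, Real.norm_of_nonneg (hM k).le]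
  rwa [show 3 * η = c by rw [hη]; ring] at h
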